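/- Setting. Let $m\ge 1$ and $\pi\in\mathbb{R}_{>0}^m$. In the Bradley--Terry paired comparison model, a design is a vector $\xi=(\xi_{uv})_{\{u,v\}\subset[m],\,u\ne v}$ of non-negative weights, indexed by the pairs of alternatives, with $\sum\xi_{uv}=1$. Put $\lambda_{uv}=\pi_u\pi_v/(\pi_u+\pi_v)^2$ for $u\neq v$. The information matrix $M(\xi,\pi)\in\mathbb{R}^{m\times m}$ is the Laplacian of the graph on $[m]$ with edge weights $\lambda_{uv}\xi_{uv}$, i.e. $M_{uv}=-\lambda_{uv}\xi_{uv}$ for $u\ne v$, with zero row sums; $M^{(m)}(\xi,\pi)$ denotes $M(\xi,\pi)$ without its last row and column. The design $\xi^*$ is $D$-optimal for $\pi$ if it maximizes $\log\det M^{(m)}(\xi,\pi)$ (with $\log 0=-\infty$) over all designs. The support graph of $\xi$ is the graph on $[m]$ whose edges are the pairs $uv$ with $\xi_{uv}>0$. A graph is decomposable (equivalently, chordal) if it is complete, or its vertex set is a union $V_1\cup V_2$ such that $V_1\cap V_2$ induces a complete graph, no edge joins $V_1\setminus V_2$ to $V_2\setminus V_1$, and the subgraphs induced on $V_1$ and on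 $V_2$ are both decomposable (all decomposable graphs being obtained from complete ones by finitely many such steps). For a symmetric $(m-1)\times(m-1)$ matrix $A$, its Farris transform is the symmetric $m\times m$ matrix $\Gamma$ with $\Gamma_{uv}=A_{uu}+A_{vv}-2A_{uv}$ for $u,v<m$, $\Gamma_{um}=\Gamma_{mu}=A_{uu}$ for $u<m$, and $\Gamma_{mm}=0$. Let $\Gamma(\xi,\pi)$ be the Farris transform of $M^{(m)}(\xi,\pi)^{-1}$. A symmetric $m\times m$ matrix $\Gamma$ with zero diagonal is called conditionally negative definite if $x^T\Gamma x<0$ for all $x\neq0$ with $\sum_u x_u=0$; for such $\Gamma$ let $L(\Gamma)$ be the symmetric $m\times m$ matrix with zero row sums whose leading $(m-1)\times(m-1)$ block is the inverse of the matrix $A$ given by the inverse Farris transform $A_{uv}=\frac12(\Gamma_{um}+\Gamma_{vm}-\Gamma_{uv})$. Theorem. Let $G$ be a decomposable graph on $[m]$. There are rational functions $r_{uv}=P_{uv}/Q_{uv}$ in $m$ variables with real coefficients, one for each pair $\{u,v\}$ and depending only on $m$ and $G$, such that for every $\pi\in\mathbb{R}_{>0}^m$ and every design $\xi^*$ that is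 $D$-optimal for $\pi$ and has support graph $G$: 1. $\xi^*$ is the unique $D$-optimal design for $\pi$. 2. $\Gamma(\xi^*,\pi)$ is the unique conditionally negative definite matrix $\Gamma$ such that $\Gamma_{uv}=(m-1)/\lambda_{uv}$ for all edges $uv$ of $G$ and $L(\Gamma)_{uv}=0$ for all non-edges $uv$, $u\neq v$, of $G$. 3. $M(\xi^*,\pi)=L(\Gamma(\xi^*,\pi))$, and $\xi^*_{uv}=-M_{uv}(\xi^*,\pi)/\lambda_{uv}$ for all $u\ne v$. 4. $Q_{uv}(\pi)\neq0$ and $\xi^*_{uv}=P_{uv}(\pi)/Q_{uv}(\pi)$ for all $u\ne v$. -/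

import Mathlib

noncomputable section

namespace DiscreteChoice

/-! ### Graphs -/

/-- The Laplacian matrix of the weighted graph on `V` with edge weights `W`
(absent edges have weight `0`; diagonal entries of `W` are ignored). -/
def weightedLaplacian {V : Type*} [Fintype V] [DecidableEq V] (W : V → V → ℝ) :
    Matrix V V ℝ :=
  fun u v => if u = v then ∑ l ∈ Finset.univ.erase u, W u l else -W u v

/-- The induced subgraph of `G` on a vertex set is decomposable if it is complete, or if its
vertex set is a union `A ∪ B` such that `A ∩ B` induces a complete graph and separates `A \ B`
from `B \ A` (no edge joins them), and the induced subgraphs on `A` and on `B` are both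
decomposable. -/
inductive DecomposableOn {V : Type*} (G : SimpleGraph V) : Set V → Prop
  | complete (S : Set V) (hS : G.IsClique S) : DecomposableOn G S
  | union (A B : Set V) (hclique : G.IsClique (A ∩ B))
      (hsep : ∀ a ∈ A \ B, ∀ b ∈ B \ A, ¬ G.Adj a b)
      (hA : DecomposableOn G A) (hB : DecomposableOn G B) : DecomposableOn G (A ∪ B)

/-- A decomposable (equivalently, chordal) graph. -/
def IsDecomposable {V : Type*} (G : SimpleGraph V) : Prop :=
  DecomposableOn G Set.univ

/-! ### Choice sets, designs and information matrices -/

/-- The choice sets with exactly `k` out of `m` alternatives. -/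
abbrev ChoiceSet (m k : ℕ) : Type := {C : Finset (Fin m) // C.card = k}

/-- The choice set `{u, v}`. -/
def pair {m : ℕ} (u v : Fin m) (h : u ≠ v) : ChoiceSet m 2 :=
  ⟨{u, v}, Finset.card_pair h⟩

/-- The information matrix of one observation from the choice set `C` at the parameter `p`: the
Laplacian of the complete graph on `C` with edge weights `p s * p t / (∑ i ∈ C, p i) ^ 2`, the
alternatives outside `C` being added as isolated vertices. -/
def choiceInformation {m k : ℕ} (C : ChoiceSet m k) (p : Fin m → ℝ) :
    Matrix (Fin m) (Fin m) ℝ :=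
  weightedLaplacian fun s t =>
    if s ∈ C.1 ∧ t ∈ C.1 then p s * p t / (∑ i ∈ C.1, p i) ^ 2 else 0

/-- The information matrix `M(ξ, p)` of a design `ξ` at the parameter `p`. -/
def information {m k : ℕ} (ξ : ChoiceSet m k → ℝ) (p : Fin m → ℝ) :
    Matrix (Fin m) (Fin m) ℝ :=
  ∑ C, ξ C • choiceInformation C p

/-- Delete the last row and the last column. -/
def reduced {n : ℕ} (M : Matrix (Fin (n + 1)) (Fin (n + 1)) ℝ) : Matrix (Fin n) (Fin n) ℝ :=
  M.submatrix Fin.castSucc Fin.castSucc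

/-- The D-criterion `log det` of the reduced information matrix, with `log 0 = -∞`.
(Reduced information matrices of designs are positive semidefinite, so nothing is lost
in `ENNReal.ofReal`.) -/
def dCriterion {n k : ℕ} (p : Fin (n + 1) → ℝ) (ξ : ChoiceSet (n + 1) k → ℝ) : EReal :=
  ENNReal.log (ENNReal.ofReal (reduced (information ξ p)).det)

/-- `ξ` is a (locally) D-optimal approximate design for the parameter `p`. -/
def IsDOptimal {n k : ℕ} (p : Fin (n + 1) → ℝ) (ξ : ChoiceSet (n + 1) k → ℝ) : Prop :=
  ξ ∈ stdSimplex ℝ (ChoiceSet (n + 1) k) ∧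
    ∀ η ∈ stdSimplex ℝ (ChoiceSet (n + 1) k), dCriterion p η ≤ dCriterion p ξ

/-- The graph on the alternatives whose edges are the pairs of positive design weight. -/
def supportGraph {m : ℕ} (ξ : ChoiceSet m 2 → ℝ) : SimpleGraph (Fin m) where
  Adj u v := ∃ h : u ≠ v, 0 < ξ (pair u v h)
  symm := ⟨by
    rintro u v ⟨h, hpos⟩
    refine ⟨h.symm, ?_⟩
    have e : pair v u h.symm = pair u v h := Subtype.ext (Finset.pair_comm v u)
    rwa [e]⟩
  loopless := ⟨fun _ ⟨h, _⟩ => h rfl⟩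

/-- `λ_uv = p_u p_v / (p_u + p_v) ^ 2`. -/
def pairIntensity {m : ℕ} (p : Fin m → ℝ) (u v : Fin m) : ℝ :=
  p u * p v / (p u + p v) ^ 2

/-! ### The Farris transform and conditionally negative definite completions -/

/-- The Farris transform of a symmetric matrix. -/
def farris {n : ℕ} (A : Matrix (Fin n) (Fin n) ℝ) : Matrix (Fin (n + 1)) (Fin (n + 1)) ℝ :=
  fun u v =>
    Fin.lastCases (motive := fun _ => ℝ)
      (Fin.lastCases (motive := fun _ => ℝ) 0 (fun j => A j j) v)
      (fun i => Fin.lastCases (motive := fun _ => ℝ) (A i i)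
        (fun j => A i i + A j j - 2 * A i j) v) u

/-- The inverse Farris transform. -/
def invFarris {n : ℕ} (Γ : Matrix (Fin (n + 1)) (Fin (n + 1)) ℝ) : Matrix (Fin n) (Fin n) ℝ :=
  fun i j => (Γ i.castSucc (Fin.last n) + Γ j.castSucc (Fin.last n)
    - Γ i.castSucc j.castSucc) / 2

/-- The matrix with vanishing row and column sums whose leading block is the symmetric
matrix `A`. -/
def extendZeroSums {n : ℕ} (A : Matrix (Fin n) (Fin n) ℝ) :
    Matrix (Fin (n + 1)) (Fin (n + 1)) ℝ :=
  fun u v =>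
    Fin.lastCases (motive := fun _ => ℝ)
      (Fin.lastCases (motive := fun _ => ℝ) (∑ i, ∑ j, A i j) (fun j => -∑ i, A j i) v)
      (fun i => Fin.lastCases (motive := fun _ => ℝ) (-∑ j, A i j) (fun j => A i j) v) u

/-- `Γ(ξ, p)`: the Farris transform of the inverse of the reduced information matrix. -/
def variogram {n k : ℕ} (ξ : ChoiceSet (n + 1) k → ℝ) (p : Fin (n + 1) → ℝ) :
    Matrix (Fin (n + 1)) (Fin (n + 1)) ℝ :=
  farris (reduced (information ξ p))⁻¹

/-- The matrix with zero row sums attached to `Γ`: invert the inverse Farris transform of `Γ`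
and extend the result to zero row and column sums. -/
def laplacianOfVariogram {n : ℕ} (Γ : Matrix (Fin (n + 1)) (Fin (n + 1)) ℝ) :
    Matrix (Fin (n + 1)) (Fin (n + 1)) ℝ :=
  extendZeroSums (invFarris Γ)⁻¹

/-- (Strictly) conditionally negative definite: symmetric, with zero diagonal, and
`xᵀ Γ x < 0` for every nonzero `x` whose entries sum to zero. -/
structure IsCondNegDef {V : Type*} [Fintype V] (Γ : Matrix V V ℝ) : Prop where
  symm : Γ.IsSymm
  diag : ∀ u, Γ u u = 0
  neg : ∀ x : V → ℝ, x ≠ 0 → ∑ u, x u = 0 → ∑ u, ∑ v, x u * Γ u v * x v < 0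

/-- `Γ` is a conditionally negative definite completion of the partial matrix that has the
entries `(m - 1) / λ_uv` at the edges `uv` of `G` (here `m = n + 1`), and the matrix attached to
`Γ` is supported on `G`, that is, it vanishes at all non-edges. -/
structure IsGraphCompletion {n : ℕ} (G : SimpleGraph (Fin (n + 1))) (p : Fin (n + 1) → ℝ)
    (Γ : Matrix (Fin (n + 1)) (Fin (n + 1)) ℝ) : Prop where
  condNegDef : IsCondNegDef Γ
  edge : ∀ u v, G.Adj u v → Γ u v = (n : ℝ) / pairIntensity p u v
  nonedge : ∀ u v, u ≠ v → ¬ G.Adj u v → laplacianOfVariogram Γ u v = 0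

end DiscreteChoice

end

/-! Uniqueness rests on strict concavity of `log det`, used in the form
`PosDef.mul_eq_one_of_trace_le`: positive definite `A`, `K` with `tr (A K) ≤ n` and `det A * det K ≥
1` are mutually inverse. For two optimal designs the trace bound is the first order condition
`IsDOptimal.trace_le`. For two completions it holds because a Laplacian supported on `G` pairs only
with the entries of `Γ` on edges and the diagonal, where all completions agree.

The first order condition at one-point designs reads `λ_uv * Γ_uv ≤ n`, with equality where the
weight is positive. This gives the edge entries of the variogram, so it is a completion
(`IsDOptimal.isGraphCompletion`).

Rationality follows the decomposition of `G`. If a separator `C = A ∩ B` splits the graph, the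
Markov property `IsLaplacianPair.mulVec_eq` expresses `Γ a b` across `C` through the solution of a
Cayley-Menger system on `C`, whose entries belong to `A` or `B` and whose determinant is nonzero by
conditional negative definiteness. By induction on the decomposition, all entries are rational in
the edge entries, hence in the parameter. Inverting then gives the Laplacian and the weights.
Rationality is stated for functions on the set of all pairs of a parameter and an optimal design
with support graph `G`, so a single quotient serves them all. -/

namespace Matrix

/-! ### Determinant and trace of positive definite matrices -/

open scoped MatrixOrder in
/-- A positive definite matrix is congruent to the identity. -/
theorem PosDef.exists_transpose_mul_self {ι : Type*} [Fintype ι] [DecidableEq ι]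
    {A : Matrix ι ι ℝ} (hA : A.PosDef) : ∃ B : Matrix ι ι ℝ, IsUnit B.det ∧ A = Bᵀ * B := by
  obtain ⟨B, hB⟩ := CStarAlgebra.nonneg_iff_eq_star_mul_self.mp hA.posSemidef.nonneg
  have hB' : A = Bᵀ * B := by simpa [star_eq_conjTranspose] using hB
  refine ⟨B, ?_, hB'⟩
  have h := hA.det_pos
  rw [hB', det_mul, det_transpose] at h
  exact isUnit_iff_ne_zero.mpr fun h0 => by simp [h0] at h

/-- Summed over the eigenvalues, `x - 1 - log x` is at most zero by the two bounds; each term is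
nonnegative and vanishes only at `x = 1`. -/
theorem PosDef.eq_one_of_trace_le_of_one_le_det {ι : Type*} [Fintype ι] [DecidableEq ι]
    {X : Matrix ι ι ℝ} (hX : X.PosDef) (htr : X.trace ≤ Fintype.card ι) (hdet : 1 ≤ X.det) :
    X = 1 := by
  have hpos := hX.eigenvalues_pos
  have htr' : ∑ i, hX.1.eigenvalues i ≤ Fintype.card ι := by
    simpa [hX.1.trace_eq_sum_eigenvalues] using htr
  have hdet' : 1 ≤ ∏ i, hX.1.eigenvalues i := by
    simpa [hX.1.det_eq_prod_eigenvalues] using hdet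
  have hlog : 0 ≤ ∑ i, Real.log (hX.1.eigenvalues i) := by
    rw [← Real.log_prod fun i _ => (hpos i).ne']
    exact Real.log_nonneg hdet'
  have hle : ∀ i, 0 ≤ hX.1.eigenvalues i - 1 - Real.log (hX.1.eigenvalues i) := fun i => by
    linarith [Real.log_le_sub_one_of_pos (hpos i)]
  have hsum : ∑ i, (hX.1.eigenvalues i - 1 - Real.log (hX.1.eigenvalues i)) = 0 := by
    refine le_antisymm ?_ (Finset.sum_nonneg fun i _ => hle i)
    simp only [Finset.sum_sub_distrib, Finset.sum_const, Finset.card_univ, nsmul_eq_mul, mul_one]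
    linarith
  have hone : ∀ i, hX.1.eigenvalues i = 1 := fun i => by
    have h0 := (Finset.sum_eq_zero_iff_of_nonneg fun i _ => hle i).mp hsum i (Finset.mem_univ i)
    by_contra h1
    linarith [Real.log_lt_sub_one_of_pos (hpos i) h1]
  have h := hX.1.spectral_theorem
  rw [show (RCLike.ofReal ∘ hX.1.eigenvalues : ι → ℝ) = fun _ => 1 from funext hone] at h
  simpa using h

/-- Equality case of the inequality between the determinant and the trace of a product of two
positive definite matrices. -/
theorem PosDef.mul_eq_one_of_trace_le {ι : Type*} [Fintype ι] [DecidableEq ι]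
    {A K : Matrix ι ι ℝ} (hA : A.PosDef) (hK : K.PosDef) (htr : (A * K).trace ≤ Fintype.card ι)
    (hdet : 1 ≤ A.det * K.det) : A * K = 1 := by
  obtain ⟨B, hBu, rfl⟩ := hA.exists_transpose_mul_self
  have hX : (B * K * Bᵀ).PosDef := by
    simpa using hK.mul_mul_conjTranspose_same (B := B)
      (vecMul_injective_iff_isUnit.mpr ((isUnit_iff_isUnit_det B).mpr hBu))
  -- `B * K * Bᵀ` is positive definite and has the trace and determinant of the product `Bᵀ * B *
  -- K`, which need not be symmetric.
  have h1 : B * K * Bᵀ = 1 := by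
    apply hX.eq_one_of_trace_le_of_one_le_det
    · rwa [trace_mul_comm, ← Matrix.mul_assoc]
    · simp only [det_mul, det_transpose] at hdet ⊢
      linarith
  rw [Matrix.mul_assoc, mul_eq_one_comm]
  exact h1

/-- First order condition for a maximum of the determinant along a segment. -/
theorem trace_nonpos_of_det_one_add_smul_le_one {ι : Type*} [Fintype ι] [DecidableEq ι]
    {H : Matrix ι ι ℝ} (h : ∀ t : ℝ, 0 < t → t ≤ 1 → det (1 + t • H) ≤ 1) : H.trace ≤ 0 := by
  -- `q` is the remainder in `det (1 + t H) = 1 + t tr H + t² q(t)`.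
  set q := (det (1 + (Polynomial.X : Polynomial ℝ) • H.map Polynomial.C)).divX.divX with hq
  have hlim : Filter.Tendsto (fun t : ℝ => H.trace + q.eval t * t) (nhdsWithin 0 (Set.Ioi 0))
      (nhds H.trace) := by
    have : Continuous fun t : ℝ => H.trace + q.eval t * t := by fun_prop
    simpa using (this.tendsto 0).mono_left nhdsWithin_le_nhds
  refine le_of_tendsto hlim ?_
  filter_upwards [Ioc_mem_nhdsGT (zero_lt_one (α := ℝ))] with t ht
  have h1 := h t ht.1 ht.2
  rw [det_one_add_smul, ← hq] at h1
  have h2 : t * (H.trace + q.eval t * t) ≤ 0 := by linarith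
  exact nonpos_of_mul_nonpos_right h2 ht.1

end Matrix

namespace DiscreteChoice

open Matrix

variable {n : ℕ}

/-! ### Farris transform, zero row sums and uniqueness of completions -/

/-- Add a last row and a last column of zeros. -/
def extendZero (A : Matrix (Fin n) (Fin n) ℝ) : Matrix (Fin (n + 1)) (Fin (n + 1)) ℝ :=
  fun u v =>
    Fin.lastCases (motive := fun _ => ℝ) 0
      (fun i => Fin.lastCases (motive := fun _ => ℝ) 0 (fun j => A i j) v) u

@[simp]
theorem extendZero_castSucc (A : Matrix (Fin n) (Fin n) ℝ) (i j : Fin n) :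
    extendZero A i.castSucc j.castSucc = A i j := by
  simp [extendZero]

@[simp]
theorem extendZero_last_left (A : Matrix (Fin n) (Fin n) ℝ) (v : Fin (n + 1)) :
    extendZero A (Fin.last n) v = 0 := by
  simp [extendZero]

@[simp]
theorem extendZero_last_right (A : Matrix (Fin n) (Fin n) ℝ) (u : Fin (n + 1)) :
    extendZero A u (Fin.last n) = 0 := by
  induction u using Fin.lastCases <;> simp [extendZero]

/-- Bordering by zeros grounds the last vertex and removes the case distinction from the Farris
transform. -/
theorem farris_apply (A : Matrix (Fin n) (Fin n) ℝ) (u v : Fin (n + 1)) :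
    farris A u v = extendZero A u u + extendZero A v v - 2 * extendZero A u v := by
  induction u using Fin.lastCases <;> induction v using Fin.lastCases <;> simp [farris]

theorem farris_isSymm {A : Matrix (Fin n) (Fin n) ℝ} (hA : A.IsSymm) : (farris A).IsSymm := by
  refine IsSymm.ext fun u v => ?_
  have h : extendZero A u v = extendZero A v u := by
    induction u using Fin.lastCases <;> induction v using Fin.lastCases <;> simp [hA.apply]
  rw [farris_apply, farris_apply, h]
  ring

theorem farris_diag (A : Matrix (Fin n) (Fin n) ℝ) (u : Fin (n + 1)) : farris A u u = 0 := by
  rw [farris_apply]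
  ring

theorem invFarris_farris {A : Matrix (Fin n) (Fin n) ℝ} : invFarris (farris A) = A := by
  ext i j
  simp only [invFarris, farris_apply, extendZero_castSucc, extendZero_last_right]
  ring

theorem farris_invFarris {Γ : Matrix (Fin (n + 1)) (Fin (n + 1)) ℝ} (hΓ : Γ.IsSymm)
    (hdiag : ∀ u, Γ u u = 0) : farris (invFarris Γ) = Γ := by
  ext u v
  rw [farris_apply]
  induction u using Fin.lastCases <;> induction v using Fin.lastCases <;>
    simp [invFarris, hdiag, hΓ.apply _ (Fin.last n)]
  ring

theorem invFarris_isSymm {Γ : Matrix (Fin (n + 1)) (Fin (n + 1)) ℝ} (hΓ : Γ.IsSymm) :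
    (invFarris Γ).IsSymm := by
  refine IsSymm.ext fun i j => ?_
  simp only [invFarris, hΓ.apply i.castSucc j.castSucc]
  ring

/-- Zero row and column sums annihilate the two diagonal terms of the Farris transform. The pairing
on the left sees `farris A` only where `L` is nonzero. -/
theorem sum_mul_farris {A : Matrix (Fin n) (Fin n) ℝ}
    {L : Matrix (Fin (n + 1)) (Fin (n + 1)) ℝ} (hL : L.IsSymm) (hrow : ∀ u, ∑ v, L u v = 0) :
    ∑ u, ∑ v, L u v * farris A u v = -2 * (A * reduced L).trace := by
  have hcol : ∀ v, ∑ u, L u v = 0 := fun v => by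
    rw [← hrow v]
    exact Finset.sum_congr rfl fun u _ => hL.apply v u
  have h1 : ∑ u, ∑ v, L u v * extendZero A u u = 0 := by
    simp [← Finset.sum_mul, hrow]
  have h2 : ∑ u, ∑ v, L u v * extendZero A v v = 0 := by
    rw [Finset.sum_comm]
    simp [← Finset.sum_mul, hcol]
  have h3 : ∑ u, ∑ v, L u v * extendZero A u v = (A * reduced L).trace := by
    simp only [Fin.sum_univ_castSucc, extendZero_castSucc, extendZero_last_left,
      extendZero_last_right, mul_zero, add_zero, Finset.sum_const_zero, trace, diag_apply,
      mul_apply, reduced, submatrix_apply]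
    refine Finset.sum_congr rfl fun i _ => Finset.sum_congr rfl fun j _ => ?_
    rw [hL.apply j.castSucc i.castSucc, mul_comm]
  have h4 : ∀ u v, L u v * farris A u v = L u v * extendZero A u u + L u v * extendZero A v v
      - 2 * (L u v * extendZero A u v) := fun u v => by
    rw [farris_apply]
    ring
  simp only [h4, Finset.sum_sub_distrib, Finset.sum_add_distrib, ← Finset.mul_sum, h1, h2, h3]
  ring

/-- The quadratic form of a Farris transform on vectors with zero sum. -/
theorem sum_sum_farris (A : Matrix (Fin n) (Fin n) ℝ) {x : Fin (n + 1) → ℝ}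
    (hx : ∑ u, x u = 0) :
    ∑ u, ∑ v, x u * farris A u v * x v =
      -2 * ((fun i : Fin n => x i.castSucc) ⬝ᵥ (A *ᵥ fun i : Fin n => x i.castSucc)) := by
  have h1 : ∑ u, ∑ v, x u * extendZero A u u * x v = 0 := by
    simp [← Finset.mul_sum, hx]
  have h2 : ∑ u, ∑ v, x u * extendZero A v v * x v = 0 := by
    simp [mul_assoc, ← Finset.mul_sum, ← Finset.sum_mul, hx]
  have h3 : ∑ u, ∑ v, x u * extendZero A u v * x v =
      (fun i : Fin n => x i.castSucc) ⬝ᵥ (A *ᵥ fun i : Fin n => x i.castSucc) := by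
    simp [Fin.sum_univ_castSucc, dotProduct, mulVec, Finset.mul_sum, mul_assoc]
  have h4 : ∀ u v, x u * farris A u v * x v = x u * extendZero A u u * x v
      + x u * extendZero A v v * x v - 2 * (x u * extendZero A u v * x v) := fun u v => by
    rw [farris_apply]
    ring
  have h5 : ∑ u, ∑ v, 2 * (x u * extendZero A u v * x v) =
      2 * ((fun i : Fin n => x i.castSucc) ⬝ᵥ (A *ᵥ fun i : Fin n => x i.castSucc)) := by
    simp only [← h3, Finset.mul_sum]
  simp only [h4, Finset.sum_sub_distrib, Finset.sum_add_distrib, h1, h2, h5]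
  ring

theorem isCondNegDef_farris {A : Matrix (Fin n) (Fin n) ℝ} (hA : A.PosDef) :
    IsCondNegDef (farris A) where
  symm := farris_isSymm (isHermitian_iff_isSymm.mp hA.1)
  diag := farris_diag A
  neg x hx0 hx := by
    rw [sum_sum_farris A hx]
    have hy : (fun i : Fin n => x i.castSucc) ≠ 0 := fun hy => hx0 <| by
      have hc : ∀ i : Fin n, x i.castSucc = 0 := fun i => congrFun hy i
      have hl : x (Fin.last n) = 0 := by simpa [Fin.sum_univ_castSucc, hc] using hx
      funext u
      induction u using Fin.lastCases <;> simp [hc, hl]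
    have := hA.dotProduct_mulVec_pos hy
    rw [star_trivial] at this
    linarith

theorem IsCondNegDef.posDef_invFarris {Γ : Matrix (Fin (n + 1)) (Fin (n + 1)) ℝ}
    (hΓ : IsCondNegDef Γ) : (invFarris Γ).PosDef := by
  refine PosDef.of_dotProduct_mulVec_pos
    (isHermitian_iff_isSymm.mpr (invFarris_isSymm hΓ.symm)) fun {y} hy => ?_
  -- The last coordinate is the one that makes the sum zero.
  set x : Fin (n + 1) → ℝ := Fin.snoc y (-∑ i, y i) with hxdef
  have hc : ∀ i : Fin n, x i.castSucc = y i := fun i => by simp [x]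
  have hx : ∑ u, x u = 0 := by simp [Fin.sum_univ_castSucc, x]
  have hx0 : x ≠ 0 := fun h => hy <| funext fun i => by rw [← hc, h]; rfl
  have h := hΓ.neg x hx0 hx
  rw [← farris_invFarris hΓ.symm hΓ.diag, sum_sum_farris _ hx] at h
  simp only [hc] at h
  rw [star_trivial]
  linarith

theorem extendZeroSums_isSymm {A : Matrix (Fin n) (Fin n) ℝ} (hA : A.IsSymm) :
    (extendZeroSums A).IsSymm := by
  refine IsSymm.ext fun u v => ?_
  induction u using Fin.lastCases <;> induction v using Fin.lastCases <;>
    simp [extendZeroSums, hA.apply]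

theorem extendZeroSums_row (A : Matrix (Fin n) (Fin n) ℝ) (u : Fin (n + 1)) :
    ∑ v, extendZeroSums A u v = 0 := by
  induction u using Fin.lastCases
  · simp only [extendZeroSums, Fin.sum_univ_castSucc, Fin.lastCases_last, Fin.lastCases_castSucc,
      Finset.sum_neg_distrib]
    exact neg_add_cancel _
  · simp [extendZeroSums, Fin.sum_univ_castSucc]

@[simp]
theorem reduced_extendZeroSums (A : Matrix (Fin n) (Fin n) ℝ) :
    reduced (extendZeroSums A) = A := by
  ext i j
  simp [reduced, extendZeroSums]

theorem extendZeroSums_reduced {L : Matrix (Fin (n + 1)) (Fin (n + 1)) ℝ} (hL : L.IsSymm)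
    (hrow : ∀ u, ∑ v, L u v = 0) : extendZeroSums (reduced L) = L := by
  have hr : ∀ u, L u (Fin.last n) = -∑ j : Fin n, L u j.castSucc := fun u => by
    have := hrow u
    rw [Fin.sum_univ_castSucc] at this
    linarith
  ext u v
  induction u using Fin.lastCases <;> induction v using Fin.lastCases
  · simp [extendZeroSums, reduced, hr (Fin.last n), hL.apply _ (Fin.last n), hr]
  · simp [extendZeroSums, reduced, ← hL.apply (Fin.last n), hr, hL.apply]
  · simp [extendZeroSums, reduced, hr]
  · simp [extendZeroSums, reduced]

theorem sum_laplacianOfVariogram_mul_farris {A : Matrix (Fin n) (Fin n) ℝ}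
    {Γ : Matrix (Fin (n + 1)) (Fin (n + 1)) ℝ} (hΓ : IsCondNegDef Γ) :
    ∑ u, ∑ v, laplacianOfVariogram Γ u v * farris A u v =
      -2 * (A * (invFarris Γ)⁻¹).trace := by
  have hs : (invFarris Γ)⁻¹.IsSymm := isHermitian_iff_isSymm.mp hΓ.posDef_invFarris.inv.1
  rw [laplacianOfVariogram, sum_mul_farris (extendZeroSums_isSymm hs) (extendZeroSums_row _),
    reduced_extendZeroSums]

/-- Conditionally negative definite completions supported on a graph are unique. -/
theorem IsGraphCompletion.unique {G : SimpleGraph (Fin (n + 1))} {p : Fin (n + 1) → ℝ}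
    {Γ Δ : Matrix (Fin (n + 1)) (Fin (n + 1)) ℝ} (hΓ : IsGraphCompletion G p Γ)
    (hΔ : IsGraphCompletion G p Δ) : Γ = Δ := by
  have key : ∀ {Γ Δ : Matrix (Fin (n + 1)) (Fin (n + 1)) ℝ}, IsGraphCompletion G p Γ →
      IsGraphCompletion G p Δ → (invFarris Γ * (invFarris Δ)⁻¹).trace = n := by
    intro Γ Δ hΓ hΔ
    have h1 := sum_laplacianOfVariogram_mul_farris (A := invFarris Γ) hΔ.condNegDef
    have h2 := sum_laplacianOfVariogram_mul_farris (A := invFarris Δ) hΔ.condNegDef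
    rw [farris_invFarris hΓ.condNegDef.symm hΓ.condNegDef.diag] at h1
    rw [farris_invFarris hΔ.condNegDef.symm hΔ.condNegDef.diag, mul_nonsing_inv _
      ((isUnit_iff_isUnit_det _).mp hΔ.condNegDef.posDef_invFarris.isUnit), trace_one] at h2
    -- On the diagonal and on edges the two completions agree; elsewhere the Laplacian of `Δ`
    -- vanishes.
    have h3 : ∑ u, ∑ v, laplacianOfVariogram Δ u v * Γ u v =
        ∑ u, ∑ v, laplacianOfVariogram Δ u v * Δ u v := by
      refine Finset.sum_congr rfl fun u _ => Finset.sum_congr rfl fun v _ => ?_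
      by_cases huv : u = v
      · rw [huv, hΓ.condNegDef.diag, hΔ.condNegDef.diag]
      by_cases hadj : G.Adj u v
      · rw [hΓ.edge u v hadj, hΔ.edge u v hadj]
      · rw [hΔ.nonedge u v huv hadj, zero_mul, zero_mul]
    rw [Fintype.card_fin] at h2
    linarith
  -- The trace is `n` in either order, so only the determinant bound remains; it holds with the
  -- larger determinant in the first factor.
  have main : ∀ {Γ Δ : Matrix (Fin (n + 1)) (Fin (n + 1)) ℝ}, IsGraphCompletion G p Γ →
      IsGraphCompletion G p Δ → (invFarris Δ).det ≤ (invFarris Γ).det → Γ = Δ := by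
    intro Γ Δ hΓ hΔ hle
    have hdΔ := hΔ.condNegDef.posDef_invFarris.det_pos
    have h1 : invFarris Γ * (invFarris Δ)⁻¹ = 1 := by
      refine hΓ.condNegDef.posDef_invFarris.mul_eq_one_of_trace_le
        hΔ.condNegDef.posDef_invFarris.inv (by rw [key hΓ hΔ, Fintype.card_fin]) ?_
      rw [det_nonsing_inv, Ring.inverse_eq_inv', ← div_eq_mul_inv]
      exact (one_le_div hdΔ).mpr hle
    have h2 : invFarris Γ = invFarris Δ := by
      have hu := (isUnit_iff_isUnit_det _).mp hΔ.condNegDef.posDef_invFarris.isUnit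
      have := congrArg (· * invFarris Δ) h1
      simpa [Matrix.mul_assoc, nonsing_inv_mul _ hu] using this
    rw [← farris_invFarris hΓ.condNegDef.symm hΓ.condNegDef.diag, h2,
      farris_invFarris hΔ.condNegDef.symm hΔ.condNegDef.diag]
  rcases le_total (invFarris Δ).det (invFarris Γ).det with h | h
  · exact main hΓ hΔ h
  · exact (main hΔ hΓ h).symm

/-! ### Information matrices as graph Laplacians -/

theorem weightedLaplacian_row {V : Type*} [Fintype V] [DecidableEq V] (W : V → V → ℝ) (u : V) :
    ∑ v, weightedLaplacian W u v = 0 := by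
  rw [← Finset.add_sum_erase _ _ (Finset.mem_univ u)]
  have h : ∑ v ∈ Finset.univ.erase u, weightedLaplacian W u v =
      -∑ v ∈ Finset.univ.erase u, W u v := by
    rw [← Finset.sum_neg_distrib]
    refine Finset.sum_congr rfl fun v hv => ?_
    simp [weightedLaplacian, (Finset.ne_of_mem_erase hv).symm]
  rw [h]
  simp [weightedLaplacian]

theorem weightedLaplacian_isSymm {V : Type*} [Fintype V] [DecidableEq V] {W : V → V → ℝ}
    (hW : ∀ u v, W u v = W v u) : (weightedLaplacian W).IsSymm := by
  refine IsSymm.ext fun u v => ?_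
  by_cases h : u = v
  · rw [h]
  · simp [weightedLaplacian, h, Ne.symm h, hW u v]

/-- The quadratic form of a symmetric matrix with zero row sums. -/
theorem dotProduct_mulVec_of_row_eq_zero {V : Type*} [Fintype V] {L : Matrix V V ℝ}
    (hL : L.IsSymm) (hrow : ∀ u, ∑ v, L u v = 0) (x : V → ℝ) :
    x ⬝ᵥ (L *ᵥ x) = ∑ u, ∑ v, -L u v * (x u - x v) ^ 2 / 2 := by
  have hcol : ∀ v, ∑ u, L u v = 0 := fun v => by
    rw [← hrow v]
    exact Finset.sum_congr rfl fun u _ => hL.apply v u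
  have h1 : ∑ u, ∑ v, L u v * x u ^ 2 / 2 = 0 := by
    simp [← Finset.sum_mul, ← Finset.sum_div, hrow]
  have h2 : ∑ u, ∑ v, L u v * x v ^ 2 / 2 = 0 := by
    rw [Finset.sum_comm]
    simp [← Finset.sum_mul, ← Finset.sum_div, hcol]
  have h3 : x ⬝ᵥ (L *ᵥ x) = ∑ u, ∑ v, x u * (L u v * x v) := by
    simp [dotProduct, mulVec, Finset.mul_sum]
  have h4 : ∀ u v, -L u v * (x u - x v) ^ 2 / 2 =
      x u * (L u v * x v) - L u v * x u ^ 2 / 2 - L u v * x v ^ 2 / 2 := fun u v => by ring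
  simp only [h4, Finset.sum_sub_distrib, h1, h2, h3, sub_zero]

variable {m : ℕ}

theorem choiceInformation_pair (p : Fin m → ℝ) {u v : Fin m} (h : u ≠ v) (C : ChoiceSet m 2) :
    choiceInformation C p u v = if C = pair u v h then -pairIntensity p u v else 0 := by
  by_cases hC : C = pair u v h
  · subst hC
    simp [choiceInformation, weightedLaplacian, h, pair, pairIntensity, Finset.sum_pair h]
  · have : ¬ (u ∈ C.1 ∧ v ∈ C.1) := fun ⟨hu, hv⟩ => hC <| Subtype.ext <| by
      refine (Finset.eq_of_subset_of_card_le (s := {u, v}) ?_ ?_).symm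
      · simp [Finset.insert_subset_iff, hu, hv]
      · rw [C.2, Finset.card_pair h]
    simp [choiceInformation, weightedLaplacian, h, hC, this]

theorem choiceInformation_isSymm {k : ℕ} (C : ChoiceSet m k) (p : Fin m → ℝ) :
    (choiceInformation C p).IsSymm :=
  weightedLaplacian_isSymm fun u v => by simp only [and_comm, mul_comm]

theorem information_apply {k : ℕ} (ξ : ChoiceSet m k → ℝ) (p : Fin m → ℝ) (u v : Fin m) :
    information ξ p u v = ∑ C, ξ C * choiceInformation C p u v := by
  simp [information, Matrix.sum_apply]

theorem information_isSymm {k : ℕ} (ξ : ChoiceSet m k → ℝ) (p : Fin m → ℝ) :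
    (information ξ p).IsSymm :=
  IsSymm.ext fun u v => by
    simp only [information_apply, (choiceInformation_isSymm _ p).apply u v]

theorem information_row {k : ℕ} (ξ : ChoiceSet m k → ℝ) (p : Fin m → ℝ) (u : Fin m) :
    ∑ v, information ξ p u v = 0 := by
  simp only [information_apply]
  rw [Finset.sum_comm]
  simp [← Finset.mul_sum, choiceInformation, weightedLaplacian_row]

theorem information_pair (ξ : ChoiceSet m 2 → ℝ) (p : Fin m → ℝ) {u v : Fin m} (h : u ≠ v) :
    information ξ p u v = -(ξ (pair u v h) * pairIntensity p u v) := by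
  simp [information_apply, choiceInformation_pair p h]

theorem pairIntensity_pos {p : Fin m → ℝ} (hp : ∀ i, 0 < p i) (u v : Fin m) :
    0 < pairIntensity p u v :=
  div_pos (mul_pos (hp u) (hp v)) (pow_pos (add_pos (hp u) (hp v)) 2)

theorem eq_neg_information_div {p : Fin m → ℝ} (hp : ∀ i, 0 < p i) (ξ : ChoiceSet m 2 → ℝ)
    {u v : Fin m} (h : u ≠ v) :
    ξ (pair u v h) = -information ξ p u v / pairIntensity p u v := by
  rw [information_pair ξ p h, neg_neg, mul_div_cancel_right₀ _ (pairIntensity_pos hp u v).ne']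

theorem exists_eq_pair (C : ChoiceSet m 2) : ∃ u v, ∃ h : u ≠ v, C = pair u v h := by
  obtain ⟨u, v, h, hC⟩ := Finset.card_eq_two.mp C.2
  exact ⟨u, v, h, Subtype.ext hC⟩

theorem information_summand_nonneg {p : Fin m → ℝ} (hp : ∀ i, 0 < p i) {ξ : ChoiceSet m 2 → ℝ}
    (hξ : ∀ C, 0 ≤ ξ C) (x : Fin m → ℝ) (u v : Fin m) :
    0 ≤ -information ξ p u v * (x u - x v) ^ 2 / 2 := by
  by_cases h : u = v
  · simp [h]
  · rw [information_pair ξ p h, neg_neg]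
    have := hξ (pair u v h)
    have := pairIntensity_pos hp u v
    positivity

theorem dotProduct_reduced_mulVec (L : Matrix (Fin (n + 1)) (Fin (n + 1)) ℝ) (y : Fin n → ℝ) :
    y ⬝ᵥ (reduced L *ᵥ y) =
      (Fin.snoc y 0 : Fin (n + 1) → ℝ) ⬝ᵥ (L *ᵥ (Fin.snoc y 0 : Fin (n + 1) → ℝ)) := by
  simp [dotProduct, mulVec, Fin.sum_univ_castSucc, reduced]

theorem reduced_isSymm {L : Matrix (Fin (n + 1)) (Fin (n + 1)) ℝ} (hL : L.IsSymm) :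
    (reduced L).IsSymm :=
  hL.submatrix _

theorem reduced_information_posSemidef {p : Fin (n + 1) → ℝ} (hp : ∀ i, 0 < p i)
    {ξ : ChoiceSet (n + 1) 2 → ℝ} (hξ : ∀ C, 0 ≤ ξ C) : (reduced (information ξ p)).PosSemidef := by
  refine PosSemidef.of_dotProduct_mulVec_nonneg
    (isHermitian_iff_isSymm.mpr (reduced_isSymm (information_isSymm ξ p))) fun y => ?_
  rw [star_trivial, dotProduct_reduced_mulVec,
    dotProduct_mulVec_of_row_eq_zero (information_isSymm ξ p) (information_row ξ p)]
  exact Finset.sum_nonneg fun u _ => Finset.sum_nonneg fun v _ =>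
    information_summand_nonneg hp hξ _ u v

theorem reduced_information_posDef {p : Fin (n + 1) → ℝ} (hp : ∀ i, 0 < p i)
    {ξ : ChoiceSet (n + 1) 2 → ℝ} (hξ : ∀ C, 0 < ξ C) : (reduced (information ξ p)).PosDef := by
  refine PosDef.of_dotProduct_mulVec_pos
    (isHermitian_iff_isSymm.mpr (reduced_isSymm (information_isSymm ξ p))) fun {y} hy => ?_
  obtain ⟨i, hi⟩ := Function.ne_iff.mp hy
  rw [star_trivial, dotProduct_reduced_mulVec,
    dotProduct_mulVec_of_row_eq_zero (information_isSymm ξ p) (information_row ξ p)]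
  have hnn := information_summand_nonneg hp (fun C => (hξ C).le) (Fin.snoc y 0)
  -- With the last vertex grounded at `0`, the edge from `i` to it contributes a positive multiple
  -- of `y i ^ 2`.
  refine Finset.sum_pos' (fun u _ => Finset.sum_nonneg fun v _ => hnn u v)
    ⟨i.castSucc, Finset.mem_univ _, Finset.sum_pos' (fun v _ => hnn _ v)
      ⟨Fin.last n, Finset.mem_univ _, ?_⟩⟩
  have hne : i.castSucc ≠ Fin.last n := (Fin.castSucc_lt_last i).ne
  rw [information_pair ξ p hne, neg_neg]
  have h1 := hξ (pair _ _ hne)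
  have h2 := pairIntensity_pos hp i.castSucc (Fin.last n)
  have h3 : y i ≠ 0 := hi
  simp only [Fin.snoc_castSucc, Fin.snoc_last, sub_zero]
  positivity

theorem dCriterion_le_iff {k : ℕ} {p : Fin (n + 1) → ℝ} {ξ η : ChoiceSet (n + 1) k → ℝ}
    (hξ : 0 ≤ (reduced (information ξ p)).det) :
    dCriterion p η ≤ dCriterion p ξ ↔
      (reduced (information η p)).det ≤ (reduced (information ξ p)).det := by
  rw [dCriterion, dCriterion, ENNReal.log_le_log_iff, ENNReal.ofReal_le_ofReal_iff hξ]

/-! ### Optimality conditions for designs -/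

section Optimal

variable {p : Fin (n + 1) → ℝ} {ξ : ChoiceSet (n + 1) 2 → ℝ}

theorem IsDOptimal.det_le (hp : ∀ i, 0 < p i) (h : IsDOptimal p ξ)
    {η : ChoiceSet (n + 1) 2 → ℝ} (hη : η ∈ stdSimplex ℝ (ChoiceSet (n + 1) 2)) :
    (reduced (information η p)).det ≤ (reduced (information ξ p)).det :=
  (dCriterion_le_iff (reduced_information_posSemidef hp h.1.1).det_nonneg).mp (h.2 η hη)

/-- The uniform design has a positive determinant, hence so does an optimal one. -/
theorem IsDOptimal.posDef (hp : ∀ i, 0 < p i) (h : IsDOptimal p ξ) :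
    (reduced (information ξ p)).PosDef := by
  -- With a single alternative there are no pairs, and weights over the empty set cannot sum to `1`.
  have hne : Nonempty (ChoiceSet (n + 1) 2) := by
    by_contra hemp
    rw [not_nonempty_iff] at hemp
    have := h.1.2
    simp at this
  set c : ℝ := (Fintype.card (ChoiceSet (n + 1) 2) : ℝ) with hcdef
  have hc : 0 < c := Nat.cast_pos.mpr Fintype.card_pos
  have hη : (fun _ => c⁻¹) ∈ stdSimplex ℝ (ChoiceSet (n + 1) 2) :=
    ⟨fun _ => (inv_pos.mpr hc).le, by
      rw [Finset.sum_const, Finset.card_univ, nsmul_eq_mul, ← hcdef, mul_inv_cancel₀ hc.ne']⟩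
  have h1 := (reduced_information_posDef hp
    (ξ := fun _ : ChoiceSet (n + 1) 2 => c⁻¹) fun _ => inv_pos.mpr hc).det_pos
  exact (reduced_information_posSemidef hp h.1.1).posDef_iff_det_ne_zero.mpr
    (h1.trans_le (h.det_le hp hη)).ne'

theorem information_add_smul_sub (ξ η : ChoiceSet (n + 1) 2 → ℝ) (p : Fin (n + 1) → ℝ) (t : ℝ) :
    information (fun C => (1 - t) * ξ C + t * η C) p =
      information ξ p + t • (information η p - information ξ p) := by
  ext u v
  simp only [information_apply, Matrix.add_apply, Matrix.smul_apply, Matrix.sub_apply, smul_eq_mul,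
    ← Finset.sum_sub_distrib, Finset.mul_sum, ← Finset.sum_add_distrib]
  exact Finset.sum_congr rfl fun C _ => by ring

/-- The equivalence theorem: the directional derivatives of the criterion at an optimal design
are nonpositive. -/
theorem IsDOptimal.trace_le (hp : ∀ i, 0 < p i) (h : IsDOptimal p ξ)
    {η : ChoiceSet (n + 1) 2 → ℝ} (hη : η ∈ stdSimplex ℝ (ChoiceSet (n + 1) 2)) :
    ((reduced (information ξ p))⁻¹ * reduced (information η p)).trace ≤ n := by
  set S := reduced (information ξ p) with hS
  have hu : IsUnit S.det := (isUnit_iff_isUnit_det _).mp (h.posDef hp).isUnit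
  have hpos : 0 < S.det := (h.posDef hp).det_pos
  have key : (S⁻¹ * (reduced (information η p) - S)).trace ≤ 0 := by
    refine trace_nonpos_of_det_one_add_smul_le_one fun t ht0 ht1 => ?_
    have hmem : (fun C => (1 - t) * ξ C + t * η C) ∈ stdSimplex ℝ (ChoiceSet (n + 1) 2) :=
      convex_stdSimplex ℝ _ h.1 hη (sub_nonneg.mpr ht1) ht0.le (sub_add_cancel 1 t)
    have hle := h.det_le hp hmem
    have heq : reduced (information (fun C => (1 - t) * ξ C + t * η C) p) =
        S * (1 + t • (S⁻¹ * (reduced (information η p) - S))) := by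
      rw [information_add_smul_sub, Matrix.mul_add, Matrix.mul_one, Matrix.mul_smul,
        ← Matrix.mul_assoc, mul_nonsing_inv _ hu, Matrix.one_mul]
      rfl
    rw [heq, det_mul, ← hS] at hle
    exact le_of_mul_le_mul_left (by rwa [mul_one]) hpos
  rw [Matrix.mul_sub, nonsing_inv_mul _ hu, trace_sub, trace_one, Fintype.card_fin] at key
  linarith

theorem trace_inv_mul_reduced_information (ξ η : ChoiceSet (n + 1) 2 → ℝ) (p : Fin (n + 1) → ℝ) :
    ((reduced (information ξ p))⁻¹ * reduced (information η p)).trace =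
      ∑ C, η C * ((reduced (information ξ p))⁻¹ * reduced (choiceInformation C p)).trace := by
  have h : reduced (information η p) = ∑ C, η C • reduced (choiceInformation C p) := by
    ext i j
    simp [reduced, information_apply, Matrix.sum_apply]
  rw [h, Finset.mul_sum, trace_sum]
  simp

theorem information_single (C : ChoiceSet (n + 1) 2) (p : Fin (n + 1) → ℝ) :
    information (Pi.single C 1) p = choiceInformation C p := by
  ext u v
  simp [information_apply, Pi.single_apply]

theorem IsDOptimal.trace_choice_le (hp : ∀ i, 0 < p i) (h : IsDOptimal p ξ)
    (C : ChoiceSet (n + 1) 2) :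
    ((reduced (information ξ p))⁻¹ * reduced (choiceInformation C p)).trace ≤ n := by
  have := h.trace_le hp (single_mem_stdSimplex ℝ C)
  rwa [information_single] at this

/-- Complementary slackness: the average of these traces under `ξ` is `n`, and none exceeds `n`. -/
theorem IsDOptimal.trace_choice_eq (hp : ∀ i, 0 < p i) (h : IsDOptimal p ξ)
    {C : ChoiceSet (n + 1) 2} (hC : 0 < ξ C) :
    ((reduced (information ξ p))⁻¹ * reduced (choiceInformation C p)).trace = n := by
  have hu := (isUnit_iff_isUnit_det _).mp (h.posDef hp).isUnit
  have h1 := trace_inv_mul_reduced_information ξ ξ p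
  rw [nonsing_inv_mul _ hu, trace_one, Fintype.card_fin] at h1
  have h2 : ∑ D, ξ D * ((n : ℝ) -
      ((reduced (information ξ p))⁻¹ * reduced (choiceInformation D p)).trace) = 0 := by
    simp only [mul_sub, Finset.sum_sub_distrib, ← h1, ← Finset.sum_mul, h.1.2, one_mul, sub_self]
  have h3 := (Finset.sum_eq_zero_iff_of_nonneg fun D _ => mul_nonneg (h.1.1 D)
    (sub_nonneg.mpr (h.trace_choice_le hp D))).mp h2 C (Finset.mem_univ C)
  have := (mul_eq_zero.mp h3).resolve_left hC.ne'
  linarith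

/-- The first order condition at `ξ` and the optimality of `η` give the equality case of the
trace-determinant inequality. The reduced matrices then coincide, and off-diagonal entries of the
full matrix determine the weights. -/
theorem IsDOptimal.unique (hp : ∀ i, 0 < p i) (h : IsDOptimal p ξ)
    {η : ChoiceSet (n + 1) 2 → ℝ} (hη : IsDOptimal p η) : η = ξ := by
  have hu := (isUnit_iff_isUnit_det _).mp (h.posDef hp).isUnit
  have h1 : (reduced (information ξ p))⁻¹ * reduced (information η p) = 1 := by
    refine (h.posDef hp).inv.mul_eq_one_of_trace_le (hη.posDef hp) ?_ ?_
    · simpa using h.trace_le hp hη.1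
    · rw [det_nonsing_inv, Ring.inverse_eq_inv', ← div_eq_inv_mul]
      exact (one_le_div (h.posDef hp).det_pos).mpr (hη.det_le hp h.1)
  have h2 : reduced (information η p) = reduced (information ξ p) := by
    have := congrArg (reduced (information ξ p) * ·) h1
    simpa [← Matrix.mul_assoc, mul_nonsing_inv _ hu] using this
  have h3 : information η p = information ξ p := by
    rw [← extendZeroSums_reduced (information_isSymm η p) (information_row η p), h2,
      extendZeroSums_reduced (information_isSymm ξ p) (information_row ξ p)]
  funext C
  obtain ⟨u, v, huv, rfl⟩ := exists_eq_pair C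
  rw [eq_neg_information_div hp η, eq_neg_information_div hp ξ, h3]

theorem pair_comm {u v : Fin m} (h : u ≠ v) : pair v u h.symm = pair u v h :=
  Subtype.ext (Finset.pair_comm v u)

theorem pairIntensity_comm (p : Fin m → ℝ) (u v : Fin m) :
    pairIntensity p v u = pairIntensity p u v := by
  simp only [pairIntensity, mul_comm, add_comm]

/-- The information of a pair is the Laplacian of a single weighted edge, so its pairing with
`farris A` meets the entry at `(u, v)` and its mirror image; this cancels the factor `-2`. The trace
thus becomes an entry of the variogram. -/
theorem trace_mul_reduced_choiceInformation_pair {A : Matrix (Fin n) (Fin n) ℝ} (hA : A.IsSymm)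
    (p : Fin (n + 1) → ℝ) {u v : Fin (n + 1)} (h : u ≠ v) :
    (A * reduced (choiceInformation (pair u v h) p)).trace =
      pairIntensity p u v * farris A u v := by
  have h1 := sum_mul_farris (A := A) (choiceInformation_isSymm (pair u v h) p)
    (weightedLaplacian_row _)
  have h2 : ∀ s t, choiceInformation (pair u v h) p s t * farris A s t =
      (if s = u ∧ t = v then -(pairIntensity p u v * farris A u v) else 0) +
      (if s = v ∧ t = u then -(pairIntensity p u v * farris A u v) else 0) := by
    intro s t
    by_cases hst : s = t
    · subst hst
      rw [farris_diag, if_neg fun hh => h (hh.1.symm.trans hh.2),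
        if_neg fun hh => h (hh.2.symm.trans hh.1)]
      ring
    · rw [choiceInformation_pair p hst]
      by_cases h3 : s = u ∧ t = v
      · obtain ⟨rfl, rfl⟩ := h3
        simp [h]
      by_cases h4 : s = v ∧ t = u
      · obtain ⟨rfl, rfl⟩ := h4
        simp [h, pair_comm h, pairIntensity_comm p s t, (farris_isSymm hA).apply s t]
      · rw [if_neg h3, if_neg h4, if_neg, zero_mul, zero_add]
        intro hp
        have hset : ({u, v} : Finset (Fin (n + 1))) = {s, t} := congrArg Subtype.val hp
        have hs : s = u ∨ s = v := by
          have : s ∈ ({u, v} : Finset (Fin (n + 1))) := by simp [hset]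
          simpa using this
        have ht : t = u ∨ t = v := by
          have : t ∈ ({u, v} : Finset (Fin (n + 1))) := by simp [hset]
          simpa using this
        grind
  simp only [h2, Finset.sum_add_distrib, ite_and, Finset.sum_ite_eq', Finset.mem_univ, if_true,
    Finset.sum_ite_irrel, Finset.sum_const_zero] at h1
  linarith

theorem IsDOptimal.laplacianOfVariogram (hp : ∀ i, 0 < p i) (h : IsDOptimal p ξ) :
    laplacianOfVariogram (variogram ξ p) = information ξ p := by
  have hu := (isUnit_iff_isUnit_det _).mp (h.posDef hp).isUnit
  rw [DiscreteChoice.laplacianOfVariogram, variogram, invFarris_farris, nonsing_inv_nonsing_inv _ hu,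
    extendZeroSums_reduced (information_isSymm ξ p) (information_row ξ p)]

/-- Edge entries come from complementary slackness, the zeros of the Laplacian from the vanishing
weights. -/
theorem IsDOptimal.isGraphCompletion (hp : ∀ i, 0 < p i) (h : IsDOptimal p ξ) :
    IsGraphCompletion (supportGraph ξ) p (variogram ξ p) where
  condNegDef := isCondNegDef_farris (h.posDef hp).inv
  edge := by
    rintro u v ⟨huv, hpos⟩
    have h1 := h.trace_choice_eq hp hpos
    rw [trace_mul_reduced_choiceInformation_pair
      (isHermitian_iff_isSymm.mp (h.posDef hp).inv.1)] at h1
    rw [eq_div_iff (pairIntensity_pos hp u v).ne', mul_comm, ← h1]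
    rfl
  nonedge u v huv hadj := by
    rw [h.laplacianOfVariogram hp, information_pair ξ p huv]
    have h0 : ξ (pair u v huv) = 0 :=
      le_antisymm (not_lt.mp fun hpos => hadj ⟨huv, hpos⟩) (h.1.1 _)
    rw [h0, zero_mul, neg_zero]

end Optimal

/-! ### Functions of a parameter that are given by a rational function -/

/-- `f` is the restriction of a rational function along `p`, whose denominator does not vanish
on the range of `p`. -/
def IsRational {ι σ : Type*} (p : ι → σ → ℝ) (f : ι → ℝ) : Prop :=
  ∃ P Q : MvPolynomial σ ℝ,
    ∀ i, MvPolynomial.eval (p i) Q ≠ 0 ∧ f i = MvPolynomial.eval (p i) P / MvPolynomial.eval (p i) Q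

namespace IsRational

variable {ι σ : Type*} {p : ι → σ → ℝ} {f g : ι → ℝ}

theorem const (p : ι → σ → ℝ) (c : ℝ) : IsRational p fun _ => c :=
  ⟨MvPolynomial.C c, 1, fun i => by simp⟩

theorem coord (p : ι → σ → ℝ) (s : σ) : IsRational p fun i => p i s :=
  ⟨MvPolynomial.X s, 1, fun i => by simp⟩

theorem add (hf : IsRational p f) (hg : IsRational p g) : IsRational p fun i => f i + g i := by
  obtain ⟨P, Q, h⟩ := hf
  obtain ⟨P', Q', h'⟩ := hg
  refine ⟨P * Q' + Q * P', Q * Q', fun i => ⟨?_, ?_⟩⟩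
  · simpa using ⟨(h i).1, (h' i).1⟩
  · simp only [(h i).2, (h' i).2]
    rw [div_add_div _ _ (h i).1 (h' i).1]
    simp

theorem mul (hf : IsRational p f) (hg : IsRational p g) : IsRational p fun i => f i * g i := by
  obtain ⟨P, Q, h⟩ := hf
  obtain ⟨P', Q', h'⟩ := hg
  refine ⟨P * P', Q * Q', fun i => ⟨?_, ?_⟩⟩
  · simpa using ⟨(h i).1, (h' i).1⟩
  · simp only [(h i).2, (h' i).2]
    rw [div_mul_div_comm]
    simp

theorem inv (hf : IsRational p f) (h0 : ∀ i, f i ≠ 0) : IsRational p fun i => (f i)⁻¹ := by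
  obtain ⟨P, Q, h⟩ := hf
  refine ⟨Q, P, fun i => ⟨fun hP => h0 i ?_, ?_⟩⟩
  · rw [(h i).2, hP, zero_div]
  · simp only [(h i).2, inv_div]

theorem neg (hf : IsRational p f) : IsRational p fun i => -f i := by
  simpa using (const p (-1)).mul hf

theorem sub (hf : IsRational p f) (hg : IsRational p g) : IsRational p fun i => f i - g i := by
  simpa [sub_eq_add_neg] using hf.add hg.neg

theorem div (hf : IsRational p f) (hg : IsRational p g) (h0 : ∀ i, g i ≠ 0) :
    IsRational p fun i => f i / g i := by
  simpa [div_eq_mul_inv] using hf.mul (hg.inv h0)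

theorem sum {κ : Type*} {s : Finset κ} {F : κ → ι → ℝ} (h : ∀ k ∈ s, IsRational p (F k)) :
    IsRational p fun i => ∑ k ∈ s, F k i := by
  classical
  induction s using Finset.induction_on with
  | empty => simpa using const p 0
  | insert a s ha ih =>
    simp only [Finset.sum_insert ha]
    exact (h a (by simp)).add (ih fun k hk => h k (by simp [hk]))

theorem prod {κ : Type*} {s : Finset κ} {F : κ → ι → ℝ} (h : ∀ k ∈ s, IsRational p (F k)) :
    IsRational p fun i => ∏ k ∈ s, F k i := by
  classical
  induction s using Finset.induction_on with
  | empty => simpa using const p 1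
  | insert a s ha ih =>
    simp only [Finset.prod_insert ha]
    exact (h a (by simp)).mul (ih fun k hk => h k (by simp [hk]))

variable {κ : Type*} [Fintype κ] [DecidableEq κ]

theorem det {N : ι → Matrix κ κ ℝ} (h : ∀ a b, IsRational p fun i => N i a b) :
    IsRational p fun i => (N i).det := by
  simp only [det_apply']
  exact sum fun τ _ => (const p _).mul (prod fun k _ => h _ _)

/-- The solution of a linear system with rational coefficients is rational. -/
theorem solution {N : ι → Matrix κ κ ℝ} {r z : ι → κ → ℝ}
    (hN : ∀ a b, IsRational p fun i => N i a b) (hr : ∀ a, IsRational p fun i => r i a)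
    (hdet : ∀ i, (N i).det ≠ 0) (hz : ∀ i, N i *ᵥ z i = r i) (a : κ) :
    IsRational p fun i => z i a := by
  -- Cramer's rule.
  have h : ∀ i, z i a = ((N i).updateCol a (r i)).det / (N i).det := fun i => by
    rw [eq_div_iff (hdet i), ← cramer_apply, ← hz i, cramer_eq_adjugate_mulVec, mulVec_mulVec,
      adjugate_mul, smul_mulVec, one_mulVec, Pi.smul_apply, smul_eq_mul, mul_comm]
  simp only [h]
  refine (det fun b c => ?_).div (det hN) hdet
  by_cases hc : c = a
  · subst hc
    simpa using hr b
  · simpa [updateCol_apply, hc] using hN b c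

theorem matrix_inv {N : ι → Matrix κ κ ℝ} (hN : ∀ a b, IsRational p fun i => N i a b)
    (hdet : ∀ i, (N i).det ≠ 0) (a b : κ) : IsRational p fun i => (N i)⁻¹ a b := by
  refine solution (z := fun i => (N i)⁻¹.col b) (r := fun _ => Pi.single b 1) hN
    (fun c => const p _) hdet (fun i => ?_) a
  rw [← mulVec_single_one, mulVec_mulVec, mul_nonsing_inv _ (isUnit_iff_ne_zero.mpr (hdet i)),
    one_mulVec]

end IsRational

/-! ### Decompositions of a graph -/

section Decomposition

variable {V : Type*} {G : SimpleGraph V}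

/-- Every decomposition of the induced subgraph on `S` extends to a decomposition of the graph
with the same separator. -/
def DecompositionsExtend (G : SimpleGraph V) (S : Set V) : Prop :=
  ∀ A B : Set V, A ∪ B = S → (∀ a ∈ A \ B, ∀ b ∈ B \ A, ¬ G.Adj a b) →
    ∃ A' B' : Set V, A ⊆ A' ∧ B ⊆ B' ∧ A' ∪ B' = Set.univ ∧
      (∀ a ∈ A' \ B', ∀ b ∈ B' \ A', ¬ G.Adj a b) ∧ A' ∩ B' = A ∩ B

theorem decompositionsExtend_univ : DecompositionsExtend G Set.univ := fun A B hAB hsep =>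
  ⟨A, B, subset_rfl, subset_rfl, hAB, hsep, rfl⟩

/-- A clique cannot meet both `A \ B` and `B \ A`, so `S ∩ T` lies on one side of the decomposition
of `S`. Adding `T` to that side leaves the separator unchanged. -/
theorem DecompositionsExtend.left {S T : Set V} (h : DecompositionsExtend G (S ∪ T))
    (hclique : G.IsClique (S ∩ T)) (hsep : ∀ a ∈ S \ T, ∀ b ∈ T \ S, ¬ G.Adj a b) :
    DecompositionsExtend G S := by
  rintro A B rfl hAB
  have hsub : (A ∪ B) ∩ T ⊆ A ∨ (A ∪ B) ∩ T ⊆ B := by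
    by_contra! hcon
    obtain ⟨x, hx, hxA⟩ := Set.not_subset.mp hcon.1
    obtain ⟨y, hy, hyB⟩ := Set.not_subset.mp hcon.2
    have hxB := hx.1.resolve_left hxA
    have hyA := hy.1.resolve_right hyB
    exact hAB y ⟨hyA, hyB⟩ x ⟨hxB, hxA⟩ (hclique hy hx fun hyx => hxA (hyx ▸ hyA))
  have hsep' : ∀ a ∈ T \ (A ∪ B), ∀ b ∈ (A ∪ B) \ T, ¬ G.Adj a b := fun a ha b hb hadj =>
    hsep b hb a ha hadj.symm
  rcases hsub with hsub | hsub
  · obtain ⟨A', B', h1, h2, h3, h4, h5⟩ := h (A ∪ T) B (by ext; simp; tauto) (by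
      rintro a ⟨ha, haB⟩ b ⟨hb, hbA⟩
      simp only [Set.mem_union, not_or] at ha hbA
      by_cases haA : a ∈ A
      · exact hAB a ⟨haA, haB⟩ b ⟨hb, hbA.1⟩
      · exact hsep' a ⟨ha.resolve_left haA, by simp [haA, haB]⟩ b ⟨Or.inr hb, hbA.2⟩)
    refine ⟨A', B', Set.subset_union_left.trans h1, h2, h3, h4, h5.trans ?_⟩
    ext x
    have := @hsub x
    simp only [Set.mem_inter_iff, Set.mem_union] at this ⊢
    tauto
  · obtain ⟨A', B', h1, h2, h3, h4, h5⟩ := h A (B ∪ T) (by ext; simp; tauto) (by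
      rintro a ⟨ha, haB⟩ b ⟨hb, hbA⟩ hadj
      simp only [Set.mem_union, not_or] at hb haB
      by_cases hbB : b ∈ B
      · exact hAB a ⟨ha, haB.1⟩ b ⟨hbB, hbA⟩ hadj
      · exact hsep a ⟨Or.inl ha, haB.2⟩ b ⟨hb.resolve_left hbB, by simp [hbB, hbA]⟩ hadj)
    refine ⟨A', B', h1, Set.subset_union_left.trans h2, h3, h4, h5.trans ?_⟩
    ext x
    have := @hsub x
    simp only [Set.mem_inter_iff, Set.mem_union] at this ⊢
    tauto

theorem DecompositionsExtend.right {S T : Set V} (h : DecompositionsExtend G (S ∪ T))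
    (hclique : G.IsClique (S ∩ T)) (hsep : ∀ a ∈ S \ T, ∀ b ∈ T \ S, ¬ G.Adj a b) :
    DecompositionsExtend G T :=
  DecompositionsExtend.left (Set.union_comm S T ▸ h) (Set.inter_comm S T ▸ hclique)
    fun a ha b hb hadj => hsep b hb a ha hadj.symm

end Decomposition

/-! ### The Markov property of conditionally negative definite matrices -/

section Markov

variable {V : Type*} [Fintype V]

/-- `L` and `Γ` are inverse to each other up to the factor `-2` on vectors with zero sum, and
the kernel of the quadratic form of `L` consists of the constant vectors. -/
structure IsLaplacianPair (L Γ : Matrix V V ℝ) : Prop where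
  symm : L.IsSymm
  row : ∀ u, ∑ v, L u v = 0
  const_of_eq_zero : ∀ x : V → ℝ, x ⬝ᵥ (L *ᵥ x) = 0 → ∀ u v, x u = x v
  mulVec_mulVec : ∀ y : V → ℝ, ∑ u, y u = 0 → L *ᵥ (Γ *ᵥ y) = (-2 : ℝ) • y

variable {L Γ : Matrix V V ℝ} {A B : Set V}

/-- With an empty separator the indicator of `A` would have zero energy without being constant. -/
theorem IsLaplacianPair.inter_nonempty (h : IsLaplacianPair L Γ) (hAB : A ∪ B = Set.univ)
    (hsep : ∀ a ∈ A \ B, ∀ b ∈ B \ A, L a b = 0) {a b : V} (ha : a ∈ A \ B) (hb : b ∈ B \ A) :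
    (A ∩ B).Nonempty := by
  classical
  by_contra hemp
  rw [Set.not_nonempty_iff_eq_empty, Set.eq_empty_iff_forall_notMem] at hemp
  have hmem : ∀ v, v ∈ A ∨ v ∈ B := fun v => by
    have : v ∈ A ∪ B := hAB ▸ Set.mem_univ v
    exact this
  have h0 := h.const_of_eq_zero (fun v => if v ∈ A then 1 else 0) (by
    rw [dotProduct]
    refine Finset.sum_eq_zero fun u _ => ?_
    by_cases hu : u ∈ A
    · have : ∑ v, L u v * (if v ∈ A then 1 else 0) = ∑ v, L u v :=
        Finset.sum_congr rfl fun v _ => by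
          by_cases hv : v ∈ A
          · simp [hv]
          · simp [hv, hsep u ⟨hu, fun huB => hemp u ⟨hu, huB⟩⟩ v ⟨(hmem v).resolve_left hv, hv⟩]
      simp only [mulVec, dotProduct]
      rw [this, h.row, mul_zero]
    · simp [hu]) a b
  simp [ha.1, hb.2] at h0

/-- If `y` has zero sum and is supported on `B`, and if `Γ y` is constant on the separator of a
decomposition `(A, B)`, then it is constant on `A`. -/
theorem IsLaplacianPair.mulVec_eq (h : IsLaplacianPair L Γ) (hAB : A ∪ B = Set.univ)
    (hsep : ∀ a ∈ A \ B, ∀ b ∈ B \ A, L a b = 0) (hne : (A ∩ B).Nonempty) {y : V → ℝ}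
    (hy : ∑ u, y u = 0) (hyB : ∀ u, u ∉ B → y u = 0) {k : ℝ}
    (hk : ∀ c ∈ A ∩ B, (Γ *ᵥ y) c = k) : ∀ a ∈ A, (Γ *ᵥ y) a = k := by
  classical
  have hmem : ∀ v, v ∈ A ∨ v ∈ B := fun v => by
    have : v ∈ A ∪ B := hAB ▸ Set.mem_univ v
    exact this
  set g : V → ℝ := fun v => (Γ *ᵥ y) v - k with hg
  -- Cutting `g` off on `B` gives zero energy: outside `B` the rows of `L` reach only `A`, where `x
  -- = g`, and there `L g = -2 y` vanishes. So `x` is constant, and it is `0` on the separator.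
  set x : V → ℝ := fun v => if v ∈ B then 0 else g v with hx
  have hLg : L *ᵥ g = (-2 : ℝ) • y := by
    have : g = Γ *ᵥ y - fun _ => k := rfl
    rw [this, mulVec_sub, h.mulVec_mulVec y hy]
    have hconst : (L *ᵥ fun _ => k) = 0 := by
      funext u
      simp [mulVec, dotProduct, ← Finset.sum_mul, h.row]
    rw [hconst, sub_zero]
  have hgC : ∀ c ∈ A, c ∈ B → g c = 0 := fun c hc hc' => sub_eq_zero.mpr (hk c ⟨hc, hc'⟩)
  have hq : x ⬝ᵥ (L *ᵥ x) = 0 := by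
    refine Finset.sum_eq_zero fun u _ => ?_
    by_cases hu : u ∈ B
    · simp [hx, hu]
    · have hLx : (L *ᵥ x) u = (L *ᵥ g) u := by
        refine Finset.sum_congr rfl fun v _ => ?_
        by_cases hv : v ∈ B
        · by_cases hvA : v ∈ A
          · simp [hx, hgC v hvA hv]
          · simp [hsep u ⟨(hmem u).resolve_right hu, hu⟩ v ⟨hv, hvA⟩]
        · simp [hx, hv]
      rw [hLx, hLg, Pi.smul_apply, hyB u hu, smul_zero, mul_zero]
  obtain ⟨c, hc⟩ := hne
  intro a ha
  by_cases haB : a ∈ B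
  · exact hk a ⟨ha, haB⟩
  · have h1 := h.const_of_eq_zero x hq a c
    simp only [hx, if_neg haB, if_pos hc.2] at h1
    exact sub_eq_zero.mp h1

end Markov

/-! ### Cayley-Menger systems and interpolation across a separator -/

/-- The Cayley-Menger matrix of the points in `C`. -/
def cayleyMenger {V : Type*} (Γ : Matrix V V ℝ) (C : Set V) : Matrix (Option C) (Option C) ℝ
  | none, none => 0
  | none, some _ => 1
  | some _, none => 1
  | some c, some d => Γ c d

section CayleyMenger

variable {V : Type*} {Γ : Matrix V V ℝ} {C : Set V} [Fintype C]

theorem cayleyMenger_mulVec_none (z : Option C → ℝ) :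
    (cayleyMenger Γ C *ᵥ z) none = ∑ c : C, z (some c) := by
  simp [mulVec, dotProduct, Fintype.sum_option, cayleyMenger]

theorem cayleyMenger_mulVec_some (z : Option C → ℝ) (c : C) :
    (cayleyMenger Γ C *ᵥ z) (some c) = z none + ∑ d : C, Γ c d * z (some d) := by
  simp [mulVec, dotProduct, Fintype.sum_option, cayleyMenger]

variable [Fintype V]

theorem sum_extend_zero (w : C → ℝ) (f : V → ℝ) :
    ∑ v, f v * Function.extend Subtype.val w 0 v = ∑ c : C, f c * w c := by
  classical
  rw [← Finset.sum_subset (Finset.subset_univ (Finset.univ.image (Subtype.val : C → V))),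
    Finset.sum_image fun _ _ _ _ h => Subtype.val_injective h]
  · exact Finset.sum_congr rfl fun c _ => by rw [Subtype.val_injective.extend_apply]
  · intro v _ hv
    rw [Function.extend_apply' _ _ _ fun ⟨c, hc⟩ => hv (Finset.mem_image.mpr ⟨c, Finset.mem_univ c, hc⟩)]
    simp

/-- A kernel vector restricts to a zero-sum vector on `C` with vanishing quadratic form, hence to
zero. Any row of a point of `C` then kills the border coordinate; an empty `C` would leave the `1 ×
1` zero matrix. -/
theorem IsCondNegDef.det_cayleyMenger_ne_zero [DecidableEq C] (hΓ : IsCondNegDef Γ)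
    (hC : C.Nonempty) : (cayleyMenger Γ C).det ≠ 0 := by
  intro hdet
  obtain ⟨z, hz0, hz⟩ := exists_mulVec_eq_zero_iff.mpr hdet
  have h1 : ∑ c : C, z (some c) = 0 := by rw [← cayleyMenger_mulVec_none (Γ := Γ), hz]; rfl
  have h2 : ∀ c : C, z none + ∑ d : C, Γ c d * z (some d) = 0 := fun c => by
    rw [← cayleyMenger_mulVec_some, hz]; rfl
  set x : V → ℝ := Function.extend Subtype.val (fun c : C => z (some c)) 0 with hx
  have hxc : ∀ c : C, x c = z (some c) := fun c => Subtype.val_injective.extend_apply _ _ c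
  have hsum : ∑ v, x v = 0 := by
    have := sum_extend_zero (fun c : C => z (some c)) fun _ => 1
    simpa [h1] using this
  have hquad : ∑ u, ∑ v, x u * Γ u v * x v = 0 := by
    have h3 : ∀ u, ∑ v, x u * Γ u v * x v = (∑ d : C, Γ u d * z (some d)) * x u := fun u => by
      rw [← sum_extend_zero, Finset.sum_mul]
      exact Finset.sum_congr rfl fun v _ => by ring
    simp only [h3]
    rw [sum_extend_zero]
    have h4 : ∀ c : C, ∑ d : C, Γ c d * z (some d) = -z none := fun c => by linarith [h2 c]
    simp only [h4, ← Finset.mul_sum, h1, mul_zero]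
  have hx0 : x = 0 := by
    by_contra hne
    exact (hΓ.neg x hne hsum).ne hquad
  have hz1 : ∀ c : C, z (some c) = 0 := fun c => by rw [← hxc, hx0]; rfl
  obtain ⟨c, hc⟩ := hC
  have hz2 : z none = 0 := by simpa [hz1] using h2 ⟨c, hc⟩
  apply hz0
  funext o
  cases o with
  | none => exact hz2
  | some c => exact hz1 c

/-- Interpolation of an entry of `Γ` across a separator. -/
theorem IsLaplacianPair.apply_eq {L : Matrix V V ℝ} (h : IsLaplacianPair L Γ) {A B : Set V}
    (hAB : A ∪ B = Set.univ) (hsep : ∀ a ∈ A \ B, ∀ b ∈ B \ A, L a b = 0) (hC : A ∩ B = C)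
    (hne : C.Nonempty) {a b : V} (ha : a ∈ A) (hb : b ∈ B) {z : Option C → ℝ}
    (hz : cayleyMenger Γ C *ᵥ z = fun o => o.elim 1 fun c => Γ c b) :
    Γ a b = z none + ∑ c : C, Γ a c * z (some c) := by
  classical
  subst hC
  have h1 : ∑ c : ↥(A ∩ B), z (some c) = 1 := by
    rw [← cayleyMenger_mulVec_none (Γ := Γ), hz]; rfl
  have h2 : ∀ c : ↥(A ∩ B), z none + ∑ d : ↥(A ∩ B), Γ c d * z (some d) = Γ c b := fun c => by
    rw [← cayleyMenger_mulVec_some, hz]; rfl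
  set x : V → ℝ := Function.extend Subtype.val (fun c : ↥(A ∩ B) => z (some c)) 0 with hx
  have hmul : ∀ u, (Γ *ᵥ (Pi.single b 1 - x)) u = Γ u b - ∑ c : ↥(A ∩ B), Γ u c * z (some c) := by
    intro u
    rw [mulVec_sub, mulVec_single_one, ← sum_extend_zero]
    rfl
  -- The border row of the system says that `e_b - x` has zero sum, the other rows that its image
  -- under `Γ` equals `z none` on the separator. The Markov property carries this value to `a`.
  have key := h.mulVec_eq hAB hsep hne (y := Pi.single b 1 - x) (k := z none) (by
      have := sum_extend_zero (fun c : ↥(A ∩ B) => z (some c)) fun _ => 1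
      simp only [one_mul] at this
      simp [Finset.sum_sub_distrib, this, h1, hx]) (by
      intro u hu
      have hub : u ≠ b := fun hub => hu (hub ▸ hb)
      have hxu : x u = 0 := Function.extend_apply' _ _ _ fun ⟨c, hc⟩ => hu (hc ▸ c.2.2)
      simp [hub, hxu]) (by
      intro c hc
      rw [hmul, ← h2 ⟨c, hc⟩]
      ring) a ha
  rw [hmul] at key
  linarith

end CayleyMenger

/-- If the entries of conditionally negative definite matrices are rational at the edges of a
decomposable graph on which the Laplacians are supported, then all entries are rational. -/
theorem DecomposableOn.isRational {ι σ V : Type*} [Fintype V] {G : SimpleGraph V}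
    {p : ι → σ → ℝ} {L Γ : ι → Matrix V V ℝ} (hpair : ∀ i, IsLaplacianPair (L i) (Γ i))
    (hneg : ∀ i, IsCondNegDef (Γ i)) (hL : ∀ i u v, u ≠ v → ¬ G.Adj u v → L i u v = 0)
    (hΓ : ∀ u v, G.Adj u v → IsRational p fun i => Γ i u v) {S : Set V}
    (hS : DecomposableOn G S) (hext : DecompositionsExtend G S) :
    ∀ u ∈ S, ∀ v ∈ S, IsRational p fun i => Γ i u v := by
  classical
  induction hS with
  | complete S hS =>
    intro u hu v hv
    by_cases huv : u = v
    · subst huv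
      simpa [(hneg _).diag] using IsRational.const p 0
    · exact hΓ u v (hS hu hv huv)
  | union A B hclique hsep hA hB ihA ihB =>
    have hA' := ihA (hext.left hclique hsep)
    have hB' := ihB (hext.right hclique hsep)
    have hcross : ∀ a ∈ A \ B, ∀ b ∈ B \ A, IsRational p fun i => Γ i a b := by
      intro a ha b hb
      -- Nonemptiness of the separator is read off from one Laplacian of the family, so the empty
      -- family is treated apart.
      rcases isEmpty_or_nonempty ι with hι | ⟨⟨i₀⟩⟩
      · exact ⟨0, 0, fun i => hι.elim i⟩
      -- The Markov property concerns the whole vertex set, so the local decomposition is enlarged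
      -- with the same separator.
      obtain ⟨A', B', h1, h2, h3, h4, h5⟩ := hext A B rfl hsep
      have hL' : ∀ i, ∀ a ∈ A' \ B', ∀ b ∈ B' \ A', L i a b = 0 := fun i a ha b hb =>
        hL i a b (fun hab => ha.2 (hab ▸ hb.1)) (h4 a ha b hb)
      have haA' : a ∈ A' \ B' := ⟨h1 ha.1, fun haB => ha.2 (h5.subset ⟨h1 ha.1, haB⟩).2⟩
      have hbB' : b ∈ B' \ A' := ⟨h2 hb.1, fun hbA => hb.2 (h5.subset ⟨hbA, h2 hb.1⟩).1⟩
      have hne : (A ∩ B).Nonempty := h5 ▸ (hpair i₀).inter_nonempty h3 (hL' i₀) haA' hbB'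
      have hdet := fun i => (hneg i).det_cayleyMenger_ne_zero hne
      set z : ι → Option ↥(A ∩ B) → ℝ := fun i =>
        (cayleyMenger (Γ i) (A ∩ B))⁻¹ *ᵥ fun o => o.elim 1 fun c => Γ i c b with hzdef
      have hz : ∀ i, cayleyMenger (Γ i) (A ∩ B) *ᵥ z i = fun o => o.elim 1 fun c => Γ i c b :=
        fun i => by
          rw [hzdef, mulVec_mulVec, mul_nonsing_inv _ (isUnit_iff_ne_zero.mpr (hdet i)),
            one_mulVec]
      -- The coefficients are entries within `A`, the right-hand side consists of entries within
      -- `B`; both are rational by induction.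
      have hrat : ∀ o, IsRational p fun i => z i o := by
        refine IsRational.solution ?_ ?_ hdet hz
        · rintro (_ | c) (_ | d)
          · exact IsRational.const p 0
          · exact IsRational.const p 1
          · exact IsRational.const p 1
          · exact hA' c c.2.1 d d.2.1
        · rintro (_ | c)
          · exact IsRational.const p 1
          · exact hB' c c.2.2 b hb.1
      simp only [fun i => (hpair i).apply_eq h3 (hL' i) h5 hne haA'.1 hbB'.1 (hz i)]
      exact (hrat none).add (IsRational.sum fun c _ => (hA' a ha.1 c c.2.1).mul (hrat (some c)))
    intro u hu v hv
    by_cases huA : u ∈ A <;> by_cases hvA : v ∈ A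
    · exact hA' u huA v hvA
    · by_cases huB : u ∈ B
      · exact hB' u huB v (hv.resolve_left hvA)
      · exact hcross u ⟨huA, huB⟩ v ⟨hv.resolve_left hvA, hvA⟩
    · by_cases hvB : v ∈ B
      · exact hB' u (hu.resolve_left huA) v hvB
      · have := hcross v ⟨hvA, hvB⟩ u ⟨hu.resolve_left huA, huA⟩
        simpa only [(hneg _).symm.apply u v] using this
    · exact hB' u (hu.resolve_left huA) v (hv.resolve_left hvA)


/-! ### Rationality of the optimal design -/

/-- On zero-sum `y` the Farris transform acts as a constant vector minus `2 E y`, with `E` the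
bordered inverse. `L` kills the constant and inverts `E` in all coordinates but the last, which the
zero column sums supply. -/
theorem mulVec_farris_inv_reduced_mulVec {L : Matrix (Fin (n + 1)) (Fin (n + 1)) ℝ}
    (hL : L.IsSymm) (hrow : ∀ u, ∑ v, L u v = 0) (hu : IsUnit (reduced L).det)
    {y : Fin (n + 1) → ℝ} (hy : ∑ u, y u = 0) :
    L *ᵥ (farris (reduced L)⁻¹ *ᵥ y) = (-2 : ℝ) • y := by
  set E := extendZero (reduced L)⁻¹ with hE
  have h1 : farris (reduced L)⁻¹ *ᵥ y = (fun _ => ∑ v, E v v * y v) - (2 : ℝ) • (E *ᵥ y) := by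
    funext u
    have h2 : ∀ v, farris (reduced L)⁻¹ u v * y v =
        E u u * y v + E v v * y v - 2 * (E u v * y v) := fun v => by
      rw [farris_apply]
      ring
    simp [mulVec, dotProduct, h2, Finset.sum_sub_distrib, Finset.sum_add_distrib,
      ← Finset.mul_sum, hy]
  have hconst : ∀ k : ℝ, (L *ᵥ fun _ => k) = 0 := fun k => by
    funext u
    simp [mulVec, dotProduct, ← Finset.sum_mul, hrow]
  have hcast : ∀ i : Fin n, (L *ᵥ (E *ᵥ y)) i.castSucc = y i.castSucc := fun i => by
    have h3 : (reduced L *ᵥ ((reduced L)⁻¹ *ᵥ fun j => y j.castSucc)) i = y i.castSucc := by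
      rw [mulVec_mulVec, mul_nonsing_inv _ hu, one_mulVec]
    rw [← h3]
    simp [hE, mulVec, dotProduct, Fin.sum_univ_castSucc, reduced]
  have hsum : ∑ u, (L *ᵥ (E *ᵥ y)) u = 0 := by
    simp only [mulVec, dotProduct]
    rw [Finset.sum_comm]
    refine Finset.sum_eq_zero fun v _ => ?_
    rw [← Finset.sum_mul, Finset.sum_congr rfl fun u _ => hL.apply v u, hrow, zero_mul]
  have hLE : L *ᵥ (E *ᵥ y) = y := by
    funext u
    induction u using Fin.lastCases with
    | last =>
      rw [Fin.sum_univ_castSucc] at hsum hy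
      simp only [hcast] at hsum
      linarith
    | cast i => exact hcast i
  rw [h1, mulVec_sub, hconst, mulVec_smul, hLE, zero_sub, neg_smul]

theorem isLaplacianPair_farris_inv_reduced {L : Matrix (Fin (n + 1)) (Fin (n + 1)) ℝ}
    (hL : L.IsSymm) (hrow : ∀ u, ∑ v, L u v = 0) (hpos : (reduced L).PosDef) :
    IsLaplacianPair L (farris (reduced L)⁻¹) where
  symm := hL
  row := hrow
  const_of_eq_zero x hx := by
    -- Subtracting the last value leaves the energy unchanged and grounds the last vertex, so
    -- definiteness of the reduced matrix applies.
    have h1 : (fun i : Fin n => x i.castSucc - x (Fin.last n)) = 0 := by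
      by_contra hne
      refine (hpos.dotProduct_mulVec_pos hne).ne' ?_
      have h2 : (Fin.snoc (fun i : Fin n => x i.castSucc - x (Fin.last n)) 0 : Fin (n + 1) → ℝ) =
          fun u => x u - x (Fin.last n) := by
        funext u
        induction u using Fin.lastCases <;> simp
      rw [star_trivial, dotProduct_reduced_mulVec, dotProduct_mulVec_of_row_eq_zero hL hrow, h2,
        ← hx, dotProduct_mulVec_of_row_eq_zero hL hrow]
      simp only [sub_sub_sub_cancel_right]
    have h3 : ∀ u, x u = x (Fin.last n) := fun u => by
      induction u using Fin.lastCases with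
      | last => rfl
      | cast i => exact sub_eq_zero.mp (congrFun h1 i)
    exact fun u v => (h3 u).trans (h3 v).symm
  mulVec_mulVec _ hy :=
    mulVec_farris_inv_reduced_mulVec hL hrow ((isUnit_iff_isUnit_det _).mp hpos.isUnit) hy

theorem isRational_extendZeroSums {ι σ : Type*} {p : ι → σ → ℝ}
    {A : ι → Matrix (Fin n) (Fin n) ℝ} (hA : ∀ a b, IsRational p fun i => A i a b)
    (u v : Fin (n + 1)) : IsRational p fun i => extendZeroSums (A i) u v := by
  induction u using Fin.lastCases <;> induction v using Fin.lastCases <;>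
    simp only [extendZeroSums, Fin.lastCases_last, Fin.lastCases_castSucc]
  · exact IsRational.sum fun a _ => IsRational.sum fun b _ => hA a b
  · exact (IsRational.sum fun b _ => hA _ b).neg
  · exact (IsRational.sum fun b _ => hA _ b).neg
  · exact hA _ _

theorem isRational_laplacianOfVariogram {ι σ : Type*} {p : ι → σ → ℝ}
    {Γ : ι → Matrix (Fin (n + 1)) (Fin (n + 1)) ℝ} (hΓ : ∀ u v, IsRational p fun i => Γ i u v)
    (hneg : ∀ i, IsCondNegDef (Γ i)) (u v : Fin (n + 1)) :
    IsRational p fun i => laplacianOfVariogram (Γ i) u v := by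
  refine isRational_extendZeroSums (fun a b => IsRational.matrix_inv (fun c d => ?_)
    (fun i => (hneg i).posDef_invFarris.det_pos.ne') a b) u v
  exact (((hΓ _ _).add (hΓ _ _)).sub (hΓ _ _)).div (IsRational.const p 2) fun _ => two_ne_zero

/-- The parameters together with a D-optimal design with support graph `G`. -/
abbrev OptimalPairs (G : SimpleGraph (Fin (n + 1))) : Type :=
  {x : (Fin (n + 1) → ℝ) × (ChoiceSet (n + 1) 2 → ℝ) //
    (∀ i, 0 < x.1 i) ∧ IsDOptimal x.1 x.2 ∧ supportGraph x.2 = G}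

theorem isRational_pairIntensity {ι : Type*} {m : ℕ} {p : ι → Fin m → ℝ} (hp : ∀ i u, 0 < p i u)
    (u v : Fin m) : IsRational p fun i => pairIntensity (p i) u v := by
  have hadd := (IsRational.coord p u).add (IsRational.coord p v)
  simp only [pairIntensity, pow_two]
  refine ((IsRational.coord p u).mul (IsRational.coord p v)).div (hadd.mul hadd) fun i => ?_
  have := add_pos (hp i u) (hp i v)
  positivity

theorem isRational_design {G : SimpleGraph (Fin (n + 1))} (hG : IsDecomposable G)
    (C : ChoiceSet (n + 1) 2) :
    IsRational (fun i : OptimalPairs G => i.1.1) fun i => i.1.2 C := by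
  have hcompl : ∀ i : OptimalPairs G, IsGraphCompletion G i.1.1 (variogram i.1.2 i.1.1) :=
    fun i => by
      have h := i.2.2.1.isGraphCompletion i.2.1
      rwa [i.2.2.2] at h
  have hlap : ∀ i : OptimalPairs G,
      laplacianOfVariogram (variogram i.1.2 i.1.1) = information i.1.2 i.1.1 :=
    fun i => i.2.2.1.laplacianOfVariogram i.2.1
  have hint := isRational_pairIntensity (p := fun i : OptimalPairs G => i.1.1) fun i => i.2.1
  have hΓ := fun u v => DecomposableOn.isRational (p := fun i : OptimalPairs G => i.1.1)
    (L := fun i => information i.1.2 i.1.1) (Γ := fun i => variogram i.1.2 i.1.1)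
    (fun i => isLaplacianPair_farris_inv_reduced (information_isSymm _ _) (information_row _ _)
      (i.2.2.1.posDef i.2.1))
    (fun i => (hcompl i).condNegDef)
    (fun i u v huv hadj => hlap i ▸ (hcompl i).nonedge u v huv hadj)
    (fun u v hadj => by
      simp only [fun i => (hcompl i).edge u v hadj]
      exact (IsRational.const _ _).div (hint u v) fun i => (pairIntensity_pos i.2.1 u v).ne')
    hG decompositionsExtend_univ u (Set.mem_univ u) v (Set.mem_univ v)
  obtain ⟨u, v, huv, rfl⟩ := exists_eq_pair C
  simp only [fun i : OptimalPairs G => eq_neg_information_div i.2.1 i.1.2 huv, ← hlap]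
  exact (isRational_laplacianOfVariogram hΓ (fun i => (hcompl i).condNegDef) u v).neg.div
    (hint u v) fun i => (pairIntensity_pos i.2.1 u v).ne'

theorem IsRational.exists_ne_zero {ι σ : Type*} {p : ι → σ → ℝ} {f : ι → ℝ}
    (hf : IsRational p f) : ∃ P Q : MvPolynomial σ ℝ, Q ≠ 0 ∧ ∀ i,
      MvPolynomial.eval (p i) Q ≠ 0 ∧
        f i = MvPolynomial.eval (p i) P / MvPolynomial.eval (p i) Q := by
  rcases isEmpty_or_nonempty ι with hι | ⟨⟨i⟩⟩
  -- If no parameter has an optimal design supported on `G`, the given denominator might be the zero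
  -- polynomial; it is replaced by `1`.
  · exact ⟨0, 1, one_ne_zero, fun i => hι.elim i⟩
  · obtain ⟨P, Q, h⟩ := hf
    exact ⟨P, Q, fun hQ => (h i).1 (by rw [hQ, map_zero]), h⟩

end DiscreteChoice

/-- There are `m = n + 1` alternatives. The rational functions `P C / Q C` depend only on the
number of alternatives and on the decomposable graph `G`. -/
theorem mainTheorem3 (n : ℕ) (G : SimpleGraph (Fin (n + 1)))
    (hG : DiscreteChoice.IsDecomposable G) :
    ∃ P Q : DiscreteChoice.ChoiceSet (n + 1) 2 → MvPolynomial (Fin (n + 1)) ℝ,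
      (∀ C, Q C ≠ 0) ∧
      ∀ p : Fin (n + 1) → ℝ, (∀ i, 0 < p i) →
      ∀ ξ : DiscreteChoice.ChoiceSet (n + 1) 2 → ℝ,
        DiscreteChoice.IsDOptimal p ξ → DiscreteChoice.supportGraph ξ = G →
        -- `ξ` is the unique D-optimal design
        (∀ η, DiscreteChoice.IsDOptimal p η → η = ξ) ∧
        -- `Γ(ξ, p)` is the unique completion of its entries on the edges
        (∀ Γ, DiscreteChoice.IsGraphCompletion G p Γ ↔ Γ = DiscreteChoice.variogram ξ p) ∧
        -- the information matrix is obtained from `Γ(ξ, p)`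
        DiscreteChoice.information ξ p =
          DiscreteChoice.laplacianOfVariogram (DiscreteChoice.variogram ξ p) ∧
        -- the design is recovered from the information matrix
        (∀ u v (h : u ≠ v), ξ (DiscreteChoice.pair u v h) =
          -DiscreteChoice.information ξ p u v / DiscreteChoice.pairIntensity p u v) ∧
        -- the design is a rational function of the parameter
        (∀ C, MvPolynomial.eval p (Q C) ≠ 0 ∧
          ξ C = MvPolynomial.eval p (P C) / MvPolynomial.eval p (Q C)) := by
  choose P Q hQ hPQ using fun C => (DiscreteChoice.isRational_design hG C).exists_ne_zero
  refine ⟨P, Q, hQ, fun p hp ξ hopt hsupp => ⟨fun η hη => hopt.unique hp hη, fun Γ => ?_,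
    (hopt.laplacianOfVariogram hp).symm, fun u v h =>
    DiscreteChoice.eq_neg_information_div hp ξ h, fun C => hPQ C ⟨(p, ξ), hp, hopt, hsupp⟩⟩⟩
  have hcompl := hopt.isGraphCompletion hp
  rw [hsupp] at hcompl
  exact ⟨fun hΓ => hΓ.unique hcompl, fun hΓ => hΓ ▸ hcompl⟩
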